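/- Let $0<\alpha\le 2$ and let $M$ be a symmetric $\alpha$-stable random measure on $\mathbb R$, over a probability space, with control measure Lebesgue measure $\mathcal L$; that is, an independently scattered, $\sigma$-additive random set function on the Borel sets of finite Lebesgue measure such that $M(A)$ has characteristic function $\theta\mapsto \exp(-\mathcal L(A)|\theta|^\alpha)$. Let $\mathcal F_\alpha$ be the set of measurable $f:\mathbb R\to\mathbb R$ with $\int|f(x)|^\alpha dx<\infty$; for $f\in\mathcal F_\alpha$ let $\int f(x)M(dx)$ be the stochastic integral, that is, the limit in probability of the integrals of simple functions that converge to $f$ in $L^\alpha$. Let $g\in\mathcal F_\alpha$ and let $Y$ be the moving average process $$Y(t)=\int g(t-x)\,M(dx)\qquad(t\in\mathbb R).$$ Let $\gamma\in\mathbb R$ with $\gamma+1/\alpha>0$, and suppose that there is a jointly measurable function $h:\mathbb R\times\mathbb R\to\mathbb R$ with $h(t,\cdot)\in\mathcal F_\alpha$ for every $t\in\mathbb R$, such that $h(t,\cdot)$ is not almost everywhere zero for at least one $t$, and such that $$\lim_{r\to0^+}\int\left|\frac{g(r(t+z))-g(rz)}{r^\gamma}-h(t,z)\right|^\alpha dz=0\qquad\text{for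 all }t\in\mathbb R.$$ Then, at every $u\in\mathbb R$, $Y$ is $(\gamma+1/\alpha)$-localisable with local form (tangent process) $Y'_u=\{\int h(t,z)\,M(dz):t\in\mathbb R\}$; that is, $Y'_u$ is non-trivial (for some $t$, $Y'_u(t)$ is not almost surely zero) and, as $r\to0^+$, the finite-dimensional distributions of the process $t\mapsto r^{-(\gamma+1/\alpha)}\bigl(Y(u+rt)-Y(u)\bigr)$ converge to those of $Y'_u$. -/

import Mathlib

open MeasureTheory ProbabilityTheory Filter Topology

noncomputable section

/-- The class `𝓕_α(E, 𝓔, m)`: measurable real functions with `∫ |f|^α dm < ∞`. -/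
def MemFAlpha {E : Type*} [MeasurableSpace E] (α : ℝ) (m : Measure E) (f : E → ℝ) : Prop :=
  Measurable f ∧ ∫⁻ x, ‖f x‖ₑ ^ α ∂m < ⊤

/-- The probability law `ν` is the symmetric `α`-stable law `S_α(σ, 0, 0)`, i.e. its
characteristic function is `θ ↦ exp (-σ^α |θ|^α)`. (For `α = 2` this is `N(0, 2σ²)`.) -/
def IsSymmStableLaw (α σ : ℝ) (ν : Measure ℝ) : Prop :=
  ∀ θ : ℝ, charFun ν θ = ((Real.exp (-(σ ^ α * |θ| ^ α)) : ℝ) : ℂ)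

/-- `M` is a symmetric `α`-stable random measure on `E` with control measure `m`: an
independently scattered, `σ`-additive random set function, defined on the measurable sets of
finite `m`-measure, with `M(A) ∼ S_α(m(A)^{1/α}, 0, 0)`.
(The values of `M` on all other sets are irrelevant.) -/
structure IsSymmStableRandomMeasure {E Ω : Type*} [MeasurableSpace E] [MeasurableSpace Ω]
    (α : ℝ) (m : Measure E) (P : Measure Ω) (M : Set E → Ω → ℝ) : Prop where
  measurable : ∀ A : Set E, MeasurableSet A → m A < ⊤ → Measurable (M A)
  law : ∀ A : Set E, MeasurableSet A → m A < ⊤ →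
    IsSymmStableLaw α ((m A).toReal ^ (1 / α)) (P.map (M A))
  indep : ∀ (n : ℕ) (A : Fin n → Set E), (∀ i, MeasurableSet (A i)) → (∀ i, m (A i) < ⊤) →
    Pairwise (Function.onFun Disjoint A) → iIndepFun (fun i => M (A i)) P
  /-- The series `∑ M(A i)` of a disjoint sequence converges almost surely, as a limit of partial
  sums (it need not converge absolutely), to the value of `M` at the union. -/
  sigma_additive : ∀ A : ℕ → Set E, (∀ i, MeasurableSet (A i)) → m (⋃ i, A i) < ⊤ →
    Pairwise (Function.onFun Disjoint A) →
    ∀ᵐ ω ∂P, Tendsto (fun n => ∑ i ∈ Finset.range n, M (A i) ω) atTop (𝓝 (M (⋃ i, A i) ω))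

/-- The integral `∑ y, y M({φ = y})` of a simple function against a random set function. The
value `y = 0` contributes nothing. -/
def simpleStableIntegral {E Ω : Type*} [MeasurableSpace E]
    (M : Set E → Ω → ℝ) (φ : SimpleFunc E ℝ) (ω : Ω) : ℝ :=
  ∑ y ∈ φ.range, y * M (φ ⁻¹' {y}) ω

/-- The random variable `X` is (a version of) the stochastic integral `∫ f dM`: the limit in
probability of the integrals of simple functions which converge to `f` in `L^α(m)`. -/
def IsStableIntegral {E Ω : Type*} [MeasurableSpace E] [MeasurableSpace Ω]
    (α : ℝ) (m : Measure E) (P : Measure Ω) (M : Set E → Ω → ℝ) (f : E → ℝ) (X : Ω → ℝ) : Prop :=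
  Measurable X ∧ ∃ φ : ℕ → SimpleFunc E ℝ,
    (∀ n, (φ n).FinMeasSupp m) ∧
    Tendsto (fun n => ∫⁻ x, ‖φ n x - f x‖ₑ ^ α ∂m) atTop (𝓝 0) ∧
    TendstoInMeasure P (fun n => simpleStableIntegral M (φ n)) atTop X

open Classical in
/-- The stochastic integral `∫ f dM`, a random variable determined up to almost sure equality
(and `0` by convention if there is no such random variable). -/
def stableIntegral {E Ω : Type*} [MeasurableSpace E] [MeasurableSpace Ω]
    (α : ℝ) (m : Measure E) (P : Measure Ω) (M : Set E → Ω → ℝ) (f : E → ℝ) : Ω → ℝ :=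
  if hX : ∃ X, IsStableIntegral α m P M f X then hX.choose else 0

/-- A process `Z` is non-trivial if it is not (a version of) the zero process. -/
def IsNontrivialProcess {Ω : Type*} [MeasurableSpace Ω] (P : Measure Ω) (Z : ℝ → Ω → ℝ) : Prop :=
  ∃ t : ℝ, ¬ (Z t =ᵐ[P] 0)

/-- The process `Y` is `H`-localisable at `u` with local form (tangent process) `Z`:
`H > 0`, `Z` is non-trivial, and `r^{-H} (Y(u + r t) - Y(u)) → Z(t)` as `r → 0⁺` in the sense of
convergence in distribution of all finite-dimensional marginals. -/
def IsLocalisableAt {Ω Ω' : Type*} [MeasurableSpace Ω] [MeasurableSpace Ω']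
    (P : Measure Ω) [IsProbabilityMeasure P] (P' : Measure Ω') [IsProbabilityMeasure P']
    (H : ℝ) (Y : ℝ → Ω → ℝ) (u : ℝ) (Z : ℝ → Ω' → ℝ) : Prop :=
  0 < H ∧ IsNontrivialProcess P' Z ∧
    ∀ (n : ℕ) (t : Fin n → ℝ),
      TendstoInDistribution
        (fun (r : ℝ) (ω : Ω) (i : Fin n) => r ^ (-H) * (Y (u + r * t i) ω - Y u ω))
        (𝓝[>] (0 : ℝ)) (fun (ω : Ω') (i : Fin n) => Z (t i) ω) (fun _ => P) P'

end

/-! A stochastic integral is symmetric stable, and its law depends on the integrand only through the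
energy `∫ |f|^α`. The integral is linear in `f` almost surely, so the joint characteristic function
of integrals of `f_1, …, f_n` at `θ` is `exp (-∫ |∑ θ_i f_i|^α)`. Convergence of finite-dimensional
distributions thus reduces to convergence of the energies of all linear combinations
(`tendstoInDistribution_stableIntegral`).

The rescaled increment of `Y` is the integral of `r^{-(γ+1/α)} (g(u + rt - x) - g(u - x))`. Under `x
= u - rz` the Jacobian `r` enters the integrand as `r^{1/α}`, which leaves `(g(r(t+z)) - g(rz)) /
r^γ`: the point `u` disappears, and this tends to `h(t, z)` in `L^α` (`alphaEnergy_comp_sub_left`).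
Energy is continuous under such convergence, also for `α < 1` (`tendsto_alphaEnergy`).
Non-triviality holds because an integral that vanishes almost surely has zero energy.

The existence of the integrals also has to be proved: simple functions converging fast enough have
almost surely Cauchy integrals, by a characteristic-function tail bound and Borel–Cantelli. -/

open scoped ENNReal

/-! ### The `α`-energy and approximation by simple functions -/

section Energy

variable {E : Type*} [MeasurableSpace E] {α : ℝ} {m : Measure E}

/-- The functional `f ↦ ∫ |f|^α dm`. -/
noncomputable def alphaEnergy (α : ℝ) (m : Measure E) (f : E → ℝ) : ℝ≥0∞ := ∫⁻ x, ‖f x‖ₑ ^ α ∂m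

/-- Each summand is at most the maximum. The crude constant serves `α` below and above 1 alike, and
is harmless for finiteness and for limits equal to zero. -/
lemma enorm_add_rpow_le (hα : 0 < α) (a b : ℝ) :
    ‖a + b‖ₑ ^ α ≤ 2 ^ α * (‖a‖ₑ ^ α + ‖b‖ₑ ^ α) := by
  calc ‖a + b‖ₑ ^ α ≤ (2 * max ‖a‖ₑ ‖b‖ₑ) ^ α := by
        gcongr
        refine (enorm_add_le a b).trans ?_
        rw [two_mul]
        gcongr
        · exact le_max_left _ _
        · exact le_max_right _ _
    _ = 2 ^ α * (max ‖a‖ₑ ‖b‖ₑ) ^ α := ENNReal.mul_rpow_of_nonneg _ _ hα.le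
    _ ≤ 2 ^ α * (‖a‖ₑ ^ α + ‖b‖ₑ ^ α) := by
        gcongr
        rcases le_total ‖a‖ₑ ‖b‖ₑ with h | h
        · rw [max_eq_right h]; exact le_add_self
        · rw [max_eq_left h]; exact le_self_add

lemma alphaEnergy_add_le (hα : 0 < α) {f g : E → ℝ} (hf : Measurable f) :
    alphaEnergy α m (fun x => f x + g x) ≤ 2 ^ α * (alphaEnergy α m f + alphaEnergy α m g) := by
  unfold alphaEnergy
  rw [← lintegral_add_left (by fun_prop), ← lintegral_const_mul' _ _
    (ENNReal.rpow_ne_top_of_nonneg hα.le (by simp))]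
  exact lintegral_mono fun x => enorm_add_rpow_le hα _ _

lemma alphaEnergy_const_mul (hα : 0 < α) (c : ℝ) (f : E → ℝ) :
    alphaEnergy α m (fun x => c * f x) = ‖c‖ₑ ^ α * alphaEnergy α m f := by
  unfold alphaEnergy
  rw [← lintegral_const_mul' _ _ (ENNReal.rpow_ne_top_of_nonneg hα.le (by simp))]
  simp_rw [enorm_mul, ENNReal.mul_rpow_of_nonneg _ _ hα.le]

lemma alphaEnergy_sub_comm (f g : E → ℝ) :
    alphaEnergy α m (fun x => f x - g x) = alphaEnergy α m (fun x => g x - f x) := by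
  unfold alphaEnergy
  simp_rw [enorm_sub_rev]

/-- A power of the energy is subadditive. -/
lemma alphaEnergy_rpow_add_le (hα : 0 < α) {f g : E → ℝ} (hf : Measurable f) (hg : Measurable g) :
    alphaEnergy α m (fun x => f x + g x) ^ (min 1 (1 / α)) ≤
      alphaEnergy α m f ^ (min 1 (1 / α)) + alphaEnergy α m g ^ (min 1 (1 / α)) := by
  rcases le_total α 1 with h | h
  · rw [min_eq_left (by rw [le_div_iff₀ hα]; linarith)]
    simp only [ENNReal.rpow_one]
    unfold alphaEnergy
    rw [← lintegral_add_left (by fun_prop)]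
    refine lintegral_mono fun x => ?_
    exact (ENNReal.rpow_le_rpow (enorm_add_le _ _) hα.le).trans
      (ENNReal.rpow_add_le_add_rpow _ _ hα.le h)
  · rw [min_eq_right (by rw [div_le_iff₀ hα]; linarith)]
    unfold alphaEnergy
    refine le_trans ?_ (ENNReal.lintegral_Lp_add_le (f := fun x => ‖f x‖ₑ)
      (g := fun x => ‖g x‖ₑ) (by fun_prop) (by fun_prop) h)
    gcongr
    exact enorm_add_le _ _

/-- The power `min 1 (1 / α)` of the energy satisfies the triangle inequality, hence squeezes
between the limit plus and minus the error; the power is then undone. Finiteness of the limit makes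
the truncated subtraction continuous. -/
lemma tendsto_alphaEnergy {ι : Type*} {l : Filter ι} (hα : 0 < α) {F : ι → E → ℝ} {f : E → ℝ}
    (hF : ∀ i, Measurable (F i)) (hf : MemFAlpha α m f)
    (h : Tendsto (fun i => alphaEnergy α m (fun x => F i x - f x)) l (𝓝 0)) :
    Tendsto (fun i => alphaEnergy α m (F i)) l (𝓝 (alphaEnergy α m f)) := by
  set p : ℝ := min 1 (1 / α)
  have hp : 0 < p := lt_min one_pos (by positivity)
  have hd : Tendsto (fun i => alphaEnergy α m (fun x => F i x - f x) ^ p) l (𝓝 0) := by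
    simpa [Function.comp_def, ENNReal.zero_rpow_of_pos hp] using (ENNReal.continuous_rpow_const (y := p)).tendsto 0 |>.comp h
  have hfin : alphaEnergy α m f ^ p ≠ ∞ := ENNReal.rpow_ne_top_of_nonneg hp.le hf.2.ne
  have key : Tendsto (fun i => alphaEnergy α m (F i) ^ p) l (𝓝 (alphaEnergy α m f ^ p)) := by
    refine tendsto_of_tendsto_of_tendsto_of_le_of_le
      (g := fun i => alphaEnergy α m f ^ p - alphaEnergy α m (fun x => F i x - f x) ^ p)
      (h := fun i => alphaEnergy α m f ^ p + alphaEnergy α m (fun x => F i x - f x) ^ p) ?_ ?_ ?_ ?_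
    · simpa using ENNReal.Tendsto.sub tendsto_const_nhds hd (Or.inl hfin)
    · simpa using tendsto_const_nhds.add hd
    · intro i
      rw [tsub_le_iff_right, alphaEnergy_sub_comm]
      have := alphaEnergy_rpow_add_le (m := m) (g := fun x => f x - F i x) hα (hF i)
        (hf.1.sub (hF i))
      simpa only [add_sub_cancel] using this
    · intro i
      have := alphaEnergy_rpow_add_le (m := m) (g := fun x => F i x - f x) hα hf.1
        ((hF i).sub hf.1)
      simpa only [add_sub_cancel] using this
  have := (ENNReal.continuous_rpow_const (y := p⁻¹)).tendsto _ |>.comp key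
  simpa [Function.comp_def, ← ENNReal.rpow_mul, mul_inv_cancel₀ hp.ne'] using this

lemma MemFAlpha.add (hα : 0 < α) {f g : E → ℝ} (hf : MemFAlpha α m f) (hg : MemFAlpha α m g) :
    MemFAlpha α m (fun x => f x + g x) :=
  ⟨hf.1.add hg.1, (alphaEnergy_add_le hα hf.1).trans_lt (ENNReal.mul_lt_top
    (ENNReal.rpow_lt_top_of_nonneg hα.le (by simp)) (ENNReal.add_lt_top.2 ⟨hf.2, hg.2⟩))⟩

lemma MemFAlpha.const_mul (hα : 0 < α) {f : E → ℝ} (hf : MemFAlpha α m f) (c : ℝ) :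
    MemFAlpha α m (fun x => c * f x) :=
  ⟨hf.1.const_mul c, (alphaEnergy_const_mul hα c f).trans_lt (ENNReal.mul_lt_top
    (ENNReal.rpow_lt_top_of_nonneg hα.le (by simp)) hf.2)⟩

lemma MemFAlpha.zero (hα : 0 < α) : MemFAlpha α m (fun _ => 0) :=
  ⟨measurable_const, by simp [ENNReal.zero_rpow_of_pos hα]⟩

lemma MemFAlpha.sum (hα : 0 < α) {ι : Type*} (s : Finset ι) {f : ι → E → ℝ}
    (hf : ∀ i, MemFAlpha α m (f i)) : MemFAlpha α m (fun x => ∑ i ∈ s, f i x) := by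
  classical
  induction s using Finset.induction_on with
  | empty => simpa using MemFAlpha.zero hα
  | insert a s ha ih => simpa [Finset.sum_insert ha] using (hf a).add hα ih

lemma tendsto_alphaEnergy_add {ι : Type*} {l : Filter ι} (hα : 0 < α) {F G : ι → E → ℝ}
    (hF : ∀ i, Measurable (F i))
    (hF0 : Tendsto (fun i => alphaEnergy α m (F i)) l (𝓝 0))
    (hG0 : Tendsto (fun i => alphaEnergy α m (G i)) l (𝓝 0)) :
    Tendsto (fun i => alphaEnergy α m (fun x => F i x + G i x)) l (𝓝 0) := by
  refine tendsto_of_tendsto_of_tendsto_of_le_of_le tendsto_const_nhds ?_ (fun i => zero_le)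
    (fun i => alphaEnergy_add_le hα (hF i))
  simpa using ENNReal.Tendsto.const_mul (hF0.add hG0)
    (Or.inr (ENNReal.rpow_ne_top_of_nonneg (x := 2) hα.le (by simp)))

lemma tendsto_alphaEnergy_const_mul {ι : Type*} {l : Filter ι} (hα : 0 < α) {F : ι → E → ℝ} (c : ℝ)
    (hF0 : Tendsto (fun i => alphaEnergy α m (F i)) l (𝓝 0)) :
    Tendsto (fun i => alphaEnergy α m (fun x => c * F i x)) l (𝓝 0) := by
  simp_rw [alphaEnergy_const_mul hα]
  simpa using ENNReal.Tendsto.const_mul hF0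
    (Or.inr (ENNReal.rpow_ne_top_of_nonneg (x := ‖c‖ₑ) hα.le (by simp)))

lemma tendsto_alphaEnergy_sum {ι κ : Type*} {l : Filter ι} (hα : 0 < α) (s : Finset κ)
    {F : κ → ι → E → ℝ} (hF : ∀ k i, Measurable (F k i))
    (hF0 : ∀ k, Tendsto (fun i => alphaEnergy α m (F k i)) l (𝓝 0)) :
    Tendsto (fun i => alphaEnergy α m (fun x => ∑ k ∈ s, F k i x)) l (𝓝 0) := by
  classical
  induction s using Finset.induction_on with
  | empty => simpa [alphaEnergy, ENNReal.zero_rpow_of_pos hα] using tendsto_const_nhds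
  | insert a s ha ih =>
    simpa [Finset.sum_insert ha] using tendsto_alphaEnergy_add hα (hF a) (hF0 a) ih

lemma exists_simpleFunc_tendsto_alphaEnergy (hα : 0 < α) {f : E → ℝ} (hf : MemFAlpha α m f) :
    ∃ φ : ℕ → SimpleFunc E ℝ, (∀ n, (φ n).FinMeasSupp m) ∧
      Tendsto (fun n => alphaEnergy α m (fun x => φ n x - f x)) atTop (𝓝 0) := by
  have hp0 : ENNReal.ofReal α ≠ 0 := by simpa using hα
  have hpt : (ENNReal.ofReal α).toReal = α := ENNReal.toReal_ofReal hα.le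
  have hE (u : E → ℝ) : eLpNorm u (ENNReal.ofReal α) m = alphaEnergy α m u ^ (1 / α) := by
    rw [eLpNorm_eq_lintegral_rpow_enorm_toReal hp0 ENNReal.ofReal_ne_top, hpt, alphaEnergy]
  have hfp : MemLp f (ENNReal.ofReal α) m :=
    ⟨hf.1.aestronglyMeasurable, by
      rw [hE]; exact ENNReal.rpow_lt_top_of_nonneg (by positivity) hf.2.ne⟩
  refine ⟨fun n => SimpleFunc.approxOn f hf.1 (Set.range f ∪ {0}) 0 (by simp) n, fun n =>
    (SimpleFunc.memLp_iff_finMeasSupp hp0 ENNReal.ofReal_ne_top).1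
      (SimpleFunc.memLp_approxOn_range hf.1 hfp n), ?_⟩
  have := SimpleFunc.tendsto_approxOn_range_Lp_eLpNorm (μ := m) ENNReal.ofReal_ne_top hf.1 hfp.2
  simp_rw [hE, Pi.sub_def] at this
  have := (ENNReal.continuous_rpow_const (y := α)).tendsto _ |>.comp this
  simpa [Function.comp_def, ← ENNReal.rpow_mul, hα.ne', ENNReal.zero_rpow_of_pos hα] using this

end Energy

/-! ### Integrals of simple functions: additivity and law -/

section SimpleIntegral

variable {E Ω : Type*} [MeasurableSpace E] [MeasurableSpace Ω] {α : ℝ} {m : Measure E}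
  {P : Measure Ω} {M : Set E → Ω → ℝ}

lemma IsSymmStableRandomMeasure.ae_empty (hM : IsSymmStableRandomMeasure α m P M) :
    ∀ᵐ ω ∂P, M ∅ ω = 0 := by
  filter_upwards [hM.sigma_additive (fun _ => ∅) (fun _ => .empty) (by simp)
    (fun _ _ _ => disjoint_bot_left)] with ω hω
  simp only [Finset.sum_const, Finset.card_range, Set.iUnion_empty, nsmul_eq_mul] at hω
  -- The partial sums are `n * M ∅ ω`; since they converge, their constant increment `M ∅ ω` must be
  -- zero.
  have h1 := (hω.comp (tendsto_add_atTop_nat 1)).sub hω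
  simp only [Function.comp_def, Nat.cast_add, Nat.cast_one, add_mul, one_mul,
    add_sub_cancel_left, sub_self] at h1
  exact tendsto_nhds_unique tendsto_const_nhds h1

lemma IsSymmStableRandomMeasure.ae_union (hM : IsSymmStableRandomMeasure α m P M) {A B : Set E}
    (hA : MeasurableSet A) (hB : MeasurableSet B) (hmA : m A < ⊤) (hmB : m B < ⊤)
    (hAB : Disjoint A B) : ∀ᵐ ω ∂P, M (A ∪ B) ω = M A ω + M B ω := by
  -- Finite additivity is σ-additivity for the sequence `A, B, ∅, ∅, …`, whose partial sums are
  -- constant from index 2 on.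
  set C : ℕ → Set E := fun n => if n = 0 then A else if n = 1 then B else ∅ with hC
  have hU : (⋃ i, C i) = A ∪ B := by
    apply subset_antisymm
    · refine Set.iUnion_subset fun i => ?_
      simp only [hC]
      split_ifs <;> simp
    · exact Set.union_subset (Set.subset_iUnion C 0) (Set.subset_iUnion C 1)
  have hmeas : ∀ i, MeasurableSet (C i) := fun i => by
    simp only [hC]; split_ifs <;> simp [hA, hB]
  have hdis : Pairwise (Function.onFun Disjoint C) := by
    intro i j hij
    simp only [hC, Function.onFun]
    split_ifs <;> simp_all [hAB.symm]
  filter_upwards [hM.sigma_additive C hmeas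
    (by rw [hU]; exact (measure_union_le _ _).trans_lt (ENNReal.add_lt_top.2 ⟨hmA, hmB⟩)) hdis,
    hM.ae_empty] with ω hω h0
  rw [hU] at hω
  refine tendsto_nhds_unique hω ?_
  rw [← tendsto_add_atTop_iff_nat 2]
  refine tendsto_const_nhds.congr fun n => ?_
  rw [Finset.sum_range_succ', Finset.sum_range_succ']
  simp [hC, h0, add_comm]

lemma IsSymmStableRandomMeasure.ae_biUnion (hM : IsSymmStableRandomMeasure α m P M) {ι : Type*}
    (s : Finset ι) {A : ι → Set E} (hA : ∀ i ∈ s, MeasurableSet (A i)) (hmA : ∀ i ∈ s, m (A i) < ⊤)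
    (hd : (s : Set ι).PairwiseDisjoint A) :
    ∀ᵐ ω ∂P, M (⋃ i ∈ s, A i) ω = ∑ i ∈ s, M (A i) ω := by
  classical
  induction s using Finset.induction_on with
  | empty => simpa using hM.ae_empty
  | insert a s ha ih =>
    have hs : ∀ i ∈ s, i ∈ insert a s := fun i hi => Finset.mem_insert_of_mem hi
    have hd' : Disjoint (A a) (⋃ i ∈ s, A i) := by
      rw [Set.disjoint_iUnion₂_right]
      exact fun i hi => hd (by simp) (by simp [hi]) (fun h => ha (h ▸ hi))
    filter_upwards [ih (fun i hi => hA i (hs i hi)) (fun i hi => hmA i (hs i hi))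
      (hd.subset (by simp)), hM.ae_union (hA a (by simp))
      (s.measurableSet_biUnion fun i hi => hA i (hs i hi)) (hmA a (by simp))
      (measure_biUnion_lt_top s.finite_toSet fun i hi => hmA i (hs i hi)) hd'] with ω h1 h2
    rw [Finset.set_biUnion_insert, Finset.sum_insert ha, h2, h1]

/-- The integral of a simple function `F ∘ χ` can be computed from the partition into level sets
of `χ`. -/
lemma simpleStableIntegral_map (hM : IsSymmStableRandomMeasure α m P M) {G : Type*} [Zero G]
    (χ : SimpleFunc E G) (hχ : χ.FinMeasSupp m) (F : G → ℝ) (hF : F 0 = 0) :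
    ∀ᵐ ω ∂P, simpleStableIntegral M (χ.map F) ω = ∑ p ∈ χ.range, F p * M (χ ⁻¹' {p}) ω := by
  classical
  have key : ∀ y ∈ (χ.map F).range, ∀ᵐ ω ∂P, y * M (χ.map F ⁻¹' {y}) ω =
      ∑ p ∈ χ.range with F p = y, F p * M (χ ⁻¹' {p}) ω := by
    intro y _
    -- The level set of 0 may have infinite measure, where nothing is known about `M`; its
    -- coefficient removes it from both sides.
    by_cases hy : y = 0
    · refine Eventually.of_forall fun ω => ?_
      rw [hy, zero_mul, Finset.sum_eq_zero]
      intro p hp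
      rw [(Finset.mem_filter.1 hp).2, zero_mul]
    · have hset : χ.map F ⁻¹' {y} = ⋃ p ∈ χ.range.filter (fun p => F p = y), χ ⁻¹' {p} := by
        ext x; simp
      filter_upwards [hM.ae_biUnion (χ.range.filter fun p => F p = y)
        (A := fun p => χ ⁻¹' {p}) (fun p _ => χ.measurableSet_fiber p)
        (fun p hp => hχ.meas_preimage_singleton_ne_zero fun h0 => hy (by
          rw [← (Finset.mem_filter.1 hp).2, h0, hF]))
        (fun p _ q _ hpq => Disjoint.preimage _ (by simpa using hpq))] with ω hω
      rw [hset, hω, Finset.mul_sum]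
      exact Finset.sum_congr rfl fun p hp => by rw [(Finset.mem_filter.1 hp).2]
  have := (Finset.eventually_all _).2 key
  filter_upwards [this] with ω hω
  rw [simpleStableIntegral, Finset.sum_congr rfl hω, SimpleFunc.range_map,
    Finset.sum_fiberwise_of_maps_to]
  exact fun p hp => Finset.mem_image_of_mem _ hp

/-- All three integrals are computed on the common partition into level sets of the pair `(φ, ψ)`,
where linearity is termwise. -/
lemma simpleStableIntegral_linearComb (hM : IsSymmStableRandomMeasure α m P M)
    {φ ψ : SimpleFunc E ℝ} (hφ : φ.FinMeasSupp m) (hψ : ψ.FinMeasSupp m) (a b : ℝ) :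
    ∀ᵐ ω ∂P, simpleStableIntegral M ((φ.pair ψ).map fun p => a * p.1 + b * p.2) ω =
      a * simpleStableIntegral M φ ω + b * simpleStableIntegral M ψ ω := by
  have hp := hφ.pair hψ
  filter_upwards [simpleStableIntegral_map hM _ hp (fun p => a * p.1 + b * p.2) (by simp),
    simpleStableIntegral_map hM _ hp Prod.fst rfl,
    simpleStableIntegral_map hM _ hp Prod.snd rfl] with ω h h1 h2
  have e1 : (φ.pair ψ).map Prod.fst = φ := by ext; rfl
  have e2 : (φ.pair ψ).map Prod.snd = ψ := by ext; rfl
  rw [e1] at h1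
  rw [e2] at h2
  rw [h, h1, h2, Finset.mul_sum, Finset.mul_sum, ← Finset.sum_add_distrib]
  exact Finset.sum_congr rfl fun p _ => by ring

lemma measurable_simpleStableIntegral (hM : IsSymmStableRandomMeasure α m P M)
    {φ : SimpleFunc E ℝ} (hφ : φ.FinMeasSupp m) : Measurable (simpleStableIntegral M φ) := by
  unfold simpleStableIntegral
  refine Finset.measurable_sum _ fun y _ => ?_
  by_cases hy : y = 0
  · simp [hy]
  · exact (hM.measurable _ (φ.measurableSet_fiber y)
      (hφ.meas_preimage_singleton_ne_zero hy)).const_mul y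

lemma alphaEnergy_simpleFunc (hα : 0 < α) {φ : SimpleFunc E ℝ} (hφ : φ.FinMeasSupp m) :
    (alphaEnergy α m φ).toReal = ∑ y ∈ φ.range, |y| ^ α * (m (φ ⁻¹' {y})).toReal := by
  have : alphaEnergy α m φ = (φ.map fun y => ‖y‖ₑ ^ α).lintegral m := by
    rw [← SimpleFunc.lintegral_eq_lintegral]; rfl
  rw [this, SimpleFunc.map_lintegral, ENNReal.toReal_sum]
  · refine Finset.sum_congr rfl fun y _ => ?_
    rw [ENNReal.toReal_mul, ← ENNReal.toReal_rpow, toReal_enorm, Real.norm_eq_abs]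
  · intro y _
    by_cases hy : y = 0
    · simp [hy, ENNReal.zero_rpow_of_pos hα]
    · exact ENNReal.mul_ne_top (ENNReal.rpow_ne_top_of_nonneg hα.le (by simp))
        (hφ.meas_preimage_singleton_ne_zero hy).ne

lemma charFun_simpleStableIntegral [IsProbabilityMeasure P] (hα : 0 < α)
    (hM : IsSymmStableRandomMeasure α m P M)
    {φ : SimpleFunc E ℝ} (hφ : φ.FinMeasSupp m) (θ : ℝ) :
    charFun (P.map (simpleStableIntegral M φ)) θ =
      ((Real.exp (-((alphaEnergy α m φ).toReal * |θ| ^ α)) : ℝ) : ℂ) := by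
  classical
  -- Independence and the stable law are available only for sets of finite measure, so the value 0
  -- is discarded before the characteristic function is factored.
  set s := φ.range.filter (fun y => y ≠ 0) with hs
  have hfin : ∀ y ∈ s, m (φ ⁻¹' {y}) < ⊤ := fun y hy =>
    hφ.meas_preimage_singleton_ne_zero (Finset.mem_filter.1 hy).2
  have hS : simpleStableIntegral M φ = fun ω => ∑ y ∈ s, y * M (φ ⁻¹' {y}) ω := by
    ext ω
    rw [simpleStableIntegral, hs, Finset.sum_filter]
    exact Finset.sum_congr rfl fun y _ => by by_cases hy : y = 0 <;> simp [hy]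
  have hind : iIndepFun (s.restrict fun y => fun ω => y * M (φ ⁻¹' {y}) ω) P := by
    let e := s.equivFin
    have h1 := hM.indep s.card (fun i => φ ⁻¹' {(e.symm i : ℝ)})
      (fun i => φ.measurableSet_fiber _) (fun i => hfin _ (e.symm i).2)
      (fun i j hij => Disjoint.preimage _ (by
        simpa [Subtype.ext_iff] using fun h => hij (e.symm.injective (Subtype.ext h))))
    have h2 := h1.precomp e.injective
    simp only [Equiv.symm_apply_apply] at h2
    exact h2.comp (fun y x => (y : ℝ) * x) fun y => measurable_const_mul _
  rw [hS, hind.charFun_map_fun_finsetSum_eq_prod fun y hy =>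
    ((hM.measurable _ (φ.measurableSet_fiber y) (hfin y hy)).const_mul y).aemeasurable,
    Finset.prod_apply]
  have hterm : ∀ y ∈ s, charFun (P.map (fun ω => y * M (φ ⁻¹' {y}) ω)) θ =
      ((Real.exp (-(|y| ^ α * (m (φ ⁻¹' {y})).toReal * |θ| ^ α)) : ℝ) : ℂ) := by
    intro y hy
    rw [charFun_map_mul_comp (hM.measurable _ (φ.measurableSet_fiber y) (hfin y hy)).aemeasurable,
      hM.law _ (φ.measurableSet_fiber y) (hfin y hy), ← Real.rpow_mul ENNReal.toReal_nonneg,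
      one_div, inv_mul_cancel₀ hα.ne', Real.rpow_one, abs_mul,
      Real.mul_rpow (abs_nonneg _) (abs_nonneg _)]
    congr 3
    ring
  rw [Finset.prod_congr rfl hterm, ← Complex.ofReal_prod, ← Real.exp_sum,
    alphaEnergy_simpleFunc hα hφ, Finset.sum_mul, ← Finset.sum_neg_distrib, hs,
    Finset.sum_filter]
  congr 2
  refine Finset.sum_congr rfl fun y _ => ?_
  by_cases hy : y = 0 <;> simp [hy, Real.zero_rpow hα.ne']

end SimpleIntegral

/-! ### Existence, linearity and law of the stochastic integral -/

section Integral

variable {E Ω : Type*} [MeasurableSpace E] [MeasurableSpace Ω] {α : ℝ} {m : Measure E}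
  {P : Measure Ω} {M : Set E → Ω → ℝ}

/-- The tail is controlled by the integral of `1 - charFun μ` over `[-2/ε, 2/ε]`, and there `1 - exp
(-x) ≤ x` bounds the integrand. -/
lemma measureReal_abs_gt_le_of_charFun {μ : Measure ℝ} [IsProbabilityMeasure μ] {d : ℝ}
    (hα : 0 < α) (hd : 0 ≤ d)
    (hμ : ∀ θ : ℝ, charFun μ θ = ((Real.exp (-(d * |θ| ^ α)) : ℝ) : ℂ)) {ε : ℝ} (hε : 0 < ε) :
    μ.real {x | ε < |x|} ≤ 2 * (d * (2 * ε⁻¹) ^ α) := by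
  refine (measureReal_abs_gt_le_integral_charFun hε).trans ?_
  have hb : ‖∫ t in (-2 * ε⁻¹)..(2 * ε⁻¹), 1 - charFun μ t‖ ≤
      d * (2 * ε⁻¹) ^ α * |2 * ε⁻¹ - -2 * ε⁻¹| := by
    refine intervalIntegral.norm_integral_le_of_norm_le_const fun t ht => ?_
    have hε' : 0 < ε⁻¹ := inv_pos.2 hε
    rw [Set.uIoc_of_le (by linarith)] at ht
    have ht' : |t| ≤ 2 * ε⁻¹ := abs_le.2 ⟨by linarith [ht.1], ht.2⟩
    have h1 : |t| ^ α ≤ (2 * ε⁻¹) ^ α := Real.rpow_le_rpow (abs_nonneg _) ht' hα.le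
    have h2 : 0 ≤ d * |t| ^ α := by positivity
    rw [hμ, ← Complex.ofReal_one, ← Complex.ofReal_sub, Complex.norm_real, Real.norm_eq_abs,
      abs_of_nonneg (by simpa using h2)]
    calc 1 - Real.exp (-(d * |t| ^ α)) ≤ d * |t| ^ α := by
          linarith [Real.add_one_le_exp (-(d * |t| ^ α))]
      _ ≤ _ := by gcongr
  refine (mul_le_mul_of_nonneg_left hb (by positivity)).trans_eq ?_
  rw [abs_of_pos (by linarith [inv_pos.2 hε])]
  field_simp
  ring

/-- If simple functions approximate `f` fast enough, their integrals converge almost surely. -/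
lemma exists_isStableIntegral [IsProbabilityMeasure P] (hα : 0 < α)
    (hM : IsSymmStableRandomMeasure α m P M) {f : E → ℝ} (hf : MemFAlpha α m f) :
    ∃ X, IsStableIntegral α m P M f X := by
  -- The denominator cancels the factor `(2 / ε)^α` of the tail bound at `ε = 2^{-k}`, so that the
  -- tail probabilities of successive differences are of order `2^{-k}`.
  set c : ℕ → ℝ := fun k => (1 / 2) ^ k / (2 * 2 ^ k) ^ α with hc
  have hc0 : ∀ k, 0 < c k := fun k => by positivity
  have hcanti : ∀ k, c (k + 1) ≤ c k := fun k => by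
    simp only [hc]
    gcongr ?_ / ?_
    · exact pow_le_pow_of_le_one (by norm_num) (by norm_num) (Nat.le_succ k)
    · gcongr
      · norm_num
      · exact Nat.le_succ k
  have hex : ∀ k, ∃ φ : SimpleFunc E ℝ, φ.FinMeasSupp m ∧
      alphaEnergy α m (fun x => φ x - f x) ≤ ENNReal.ofReal (c k) := by
    intro k
    obtain ⟨φ, h1, h2⟩ := exists_simpleFunc_tendsto_alphaEnergy hα hf
    obtain ⟨n, hn⟩ := (h2.eventually_le_const (ENNReal.ofReal_pos.2 (hc0 k))).exists
    exact ⟨φ n, h1 n, hn⟩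
  choose φ hφ hφc using hex
  have hcsum : Summable fun k : ℕ => (1 / 2 : ℝ) ^ k := summable_geometric_two
  have hclim : Tendsto c atTop (𝓝 0) := by
    refine squeeze_zero (fun k => (hc0 k).le) (fun k => ?_) hcsum.tendsto_atTop_zero
    refine div_le_self (by positivity) (Real.one_le_rpow ?_ hα.le)
    have : (1 : ℝ) ≤ 2 ^ k := one_le_pow₀ (by norm_num)
    linarith
  have hlim : Tendsto (fun n => alphaEnergy α m (fun x => φ n x - f x)) atTop (𝓝 0) := by
    refine tendsto_of_tendsto_of_tendsto_of_le_of_le tendsto_const_nhds ?_ (fun _ => zero_le) hφc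
    simpa using ENNReal.tendsto_ofReal hclim
  set δ : ℕ → SimpleFunc E ℝ := fun k =>
    ((φ (k + 1)).pair (φ k)).map fun p => 1 * p.1 + (-1) * p.2 with hδ
  have hδfin : ∀ k, (δ k).FinMeasSupp m := fun k =>
    ((hφ (k + 1)).pair (hφ k)).map (by simp)
  have hδe : ∀ k, (alphaEnergy α m (δ k)).toReal ≤ 2 ^ α * (2 * c k) := by
    intro k
    have h1 : alphaEnergy α m (δ k) ≤ 2 ^ α * (ENNReal.ofReal (c k) + ENNReal.ofReal (c k)) := by
      have h2 := alphaEnergy_add_le (m := m) (f := fun x => φ (k + 1) x - f x)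
        (g := fun x => f x - φ k x) hα ((φ (k + 1)).measurable.sub hf.1)
      have h3 : (fun x => φ (k + 1) x - f x + (f x - φ k x)) = δ k := by
        ext x; simp [hδ]; ring
      rw [h3] at h2
      refine h2.trans ?_
      gcongr
      · exact (hφc (k + 1)).trans (ENNReal.ofReal_le_ofReal (hcanti k))
      · rw [alphaEnergy_sub_comm]; exact hφc k
    refine (ENNReal.toReal_mono ?_ h1).trans_eq ?_
    · exact ENNReal.mul_ne_top (ENNReal.rpow_ne_top_of_nonneg hα.le (by simp)) (by simp)
    · rw [ENNReal.toReal_mul, ← ENNReal.toReal_rpow, ENNReal.toReal_add (by simp) (by simp),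
        ENNReal.toReal_ofReal (hc0 k).le, ENNReal.toReal_ofNat]
      ring
  have htail : ∀ k, P {ω | (1 / 2 : ℝ) ^ k < |simpleStableIntegral M (δ k) ω|} ≤
      ENNReal.ofReal (4 * 2 ^ α * (1 / 2) ^ k) := by
    intro k
    have hm := measurable_simpleStableIntegral hM (hδfin k)
    have : IsProbabilityMeasure (P.map (simpleStableIntegral M (δ k))) :=
      Measure.isProbabilityMeasure_map hm.aemeasurable
    have h1 := measureReal_abs_gt_le_of_charFun hα ENNReal.toReal_nonneg
      (charFun_simpleStableIntegral hα hM (hδfin k)) (ε := (1 / 2 : ℝ) ^ k) (by positivity)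
    rw [map_measureReal_apply hm (measurableSet_lt measurable_const (by fun_prop))] at h1
    rw [← ofReal_measureReal]
    refine ENNReal.ofReal_le_ofReal (h1.trans ?_)
    calc 2 * ((alphaEnergy α m (δ k)).toReal * (2 * ((1 / 2 : ℝ) ^ k)⁻¹) ^ α)
        ≤ 2 * (2 ^ α * (2 * c k) * (2 * ((1 / 2 : ℝ) ^ k)⁻¹) ^ α) := by gcongr; exact hδe k
      _ = 4 * 2 ^ α * (1 / 2) ^ k := by
        have h3 : ((1 / 2 : ℝ) ^ k)⁻¹ = 2 ^ k := by simp
        have h4 : ((2 : ℝ) * 2 ^ k) ^ α ≠ 0 := by positivity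
        simp only [hc]
        rw [h3]
        field_simp
        norm_num
  -- Borel–Cantelli: almost surely, successive differences are eventually at most `2^{-k}`, so the
  -- integrals form a Cauchy sequence.
  have hBC : ∀ᵐ ω ∂P, ∀ᶠ k in atTop,
      ω ∉ {ω | (1 / 2 : ℝ) ^ k < |simpleStableIntegral M (δ k) ω|} := by
    refine ae_eventually_notMem (ne_top_of_le_ne_top ?_ (ENNReal.tsum_le_tsum htail))
    exact (hcsum.mul_left _).tsum_ofReal_ne_top
  have hconv : ∀ᵐ ω ∂P, ∃ l, Tendsto (fun n => simpleStableIntegral M (φ n) ω) atTop (𝓝 l) := by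
    filter_upwards [hBC, ae_all_iff.2 fun k =>
      simpleStableIntegral_linearComb hM (hφ (k + 1)) (hφ k) 1 (-1)] with ω h1 h2
    refine cauchySeq_tendsto_of_complete (cauchySeq_of_summable_dist ?_)
    refine hcsum.of_norm_bounded_eventually_nat ?_
    filter_upwards [h1] with k hk
    have h3 : simpleStableIntegral M (δ k) ω = simpleStableIntegral M (φ (k + 1)) ω -
        simpleStableIntegral M (φ k) ω := (h2 k).trans (by ring)
    have hk := not_lt.1 hk
    rw [h3] at hk
    rw [dist_comm, Real.dist_eq, Real.norm_eq_abs, abs_abs]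
    exact hk
  have hmeas := fun n => measurable_simpleStableIntegral hM (hφ n)
  obtain ⟨X, hX, hXlim⟩ := measurable_limit_of_tendsto_metrizable_ae
    (fun n => (hmeas n).aemeasurable) hconv
  exact ⟨X, hX, φ, hφ, hlim,
    tendstoInMeasure_of_tendsto_ae (fun n => (hmeas n).aestronglyMeasurable) hXlim⟩

lemma isStableIntegral_stableIntegral [IsProbabilityMeasure P] (hα : 0 < α)
    (hM : IsSymmStableRandomMeasure α m P M) {f : E → ℝ} (hf : MemFAlpha α m f) :
    IsStableIntegral α m P M f (stableIntegral α m P M f) := by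
  have h := exists_isStableIntegral hα hM hf
  rw [stableIntegral, dif_pos h]
  exact h.choose_spec

/-- A subsequence turns convergence in probability into almost sure convergence, after which limits
can be combined pointwise. -/
lemma IsStableIntegral.exists_tendsto_ae {f : E → ℝ} {X : Ω → ℝ}
    (h : IsStableIntegral α m P M f X) : ∃ φ : ℕ → SimpleFunc E ℝ, (∀ n, (φ n).FinMeasSupp m) ∧
      Tendsto (fun n => alphaEnergy α m (fun x => φ n x - f x)) atTop (𝓝 0) ∧
      ∀ᵐ ω ∂P, Tendsto (fun n => simpleStableIntegral M (φ n) ω) atTop (𝓝 (X ω)) := by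
  obtain ⟨-, φ, h1, h2, h3⟩ := h
  obtain ⟨ns, hns, h4⟩ := h3.exists_seq_tendsto_ae
  exact ⟨fun n => φ (ns n), fun n => h1 _, h2.comp hns.tendsto_atTop, h4⟩

lemma IsStableIntegral.zero [IsProbabilityMeasure P] (hα : 0 < α) :
    IsStableIntegral α m P M (fun _ => 0) (fun _ => 0) := by
  refine ⟨measurable_const, fun _ => 0, fun _ => ?_, ?_, ?_⟩
  · simp [SimpleFunc.finMeasSupp_iff_support]
  · simp [ENNReal.zero_rpow_of_pos hα]
  · have h0 : simpleStableIntegral M (0 : SimpleFunc E ℝ) = fun _ : Ω => (0 : ℝ) := by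
      ext ω
      refine Finset.sum_eq_zero fun y hy => ?_
      obtain ⟨x, hx⟩ := SimpleFunc.mem_range.1 hy
      rw [← hx, SimpleFunc.coe_zero, Pi.zero_apply, zero_mul]
    simp only [h0]
    exact tendstoInMeasure_of_tendsto_ae (fun _ => aestronglyMeasurable_const)
      (Eventually.of_forall fun _ => tendsto_const_nhds)

lemma IsStableIntegral.linearComb [IsProbabilityMeasure P] (hα : 0 < α)
    (hM : IsSymmStableRandomMeasure α m P M) {f g : E → ℝ} {X Y : Ω → ℝ}
    (hf : MemFAlpha α m f)
    (hX : IsStableIntegral α m P M f X) (hY : IsStableIntegral α m P M g Y) (a b : ℝ) :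
    IsStableIntegral α m P M (fun x => a * f x + b * g x) (fun ω => a * X ω + b * Y ω) := by
  obtain ⟨φ, hφ, hφf, hφX⟩ := hX.exists_tendsto_ae
  obtain ⟨ψ, hψ, hψg, hψY⟩ := hY.exists_tendsto_ae
  have hfin : ∀ n, (((φ n).pair (ψ n)).map fun p => a * p.1 + b * p.2).FinMeasSupp m :=
    fun n => ((hφ n).pair (hψ n)).map (by simp)
  refine ⟨(hX.1.const_mul a).add (hY.1.const_mul b),
    fun n => ((φ n).pair (ψ n)).map fun p => a * p.1 + b * p.2, hfin, ?_, ?_⟩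
  · have h1 := tendsto_alphaEnergy_add hα
      (fun n => (((φ n).measurable.sub hf.1).const_mul a))
      (tendsto_alphaEnergy_const_mul hα a hφf) (tendsto_alphaEnergy_const_mul hα b hψg)
    refine h1.congr fun n => ?_
    unfold alphaEnergy
    refine lintegral_congr fun x => ?_
    congr 2
    simp only [SimpleFunc.map_apply, SimpleFunc.pair_apply, Pi.sub_apply]
    ring
  · refine tendstoInMeasure_of_tendsto_ae
      (fun n => (measurable_simpleStableIntegral hM (hfin n)).aestronglyMeasurable) ?_
    filter_upwards [hφX, hψY, ae_all_iff.2 fun n =>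
      simpleStableIntegral_linearComb hM (hφ n) (hψ n) a b] with ω h1 h2 h3
    simp_rw [h3]
    exact (h1.const_mul a).add (h2.const_mul b)

lemma IsStableIntegral.sum [IsProbabilityMeasure P] (hα : 0 < α)
    (hM : IsSymmStableRandomMeasure α m P M) {ι : Type*} (s : Finset ι) {f : ι → E → ℝ}
    {X : ι → Ω → ℝ} (hf : ∀ i, MemFAlpha α m (f i)) (hX : ∀ i, IsStableIntegral α m P M (f i) (X i))
    (c : ι → ℝ) :
    IsStableIntegral α m P M (fun x => ∑ i ∈ s, c i * f i x) (fun ω => ∑ i ∈ s, c i * X i ω) := by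
  classical
  induction s using Finset.induction_on with
  | empty => simpa using IsStableIntegral.zero hα
  | insert a s ha ih =>
    simpa [Finset.sum_insert ha] using IsStableIntegral.linearComb hα hM (hf a) (hX a) ih (c a) 1

/-- The stochastic integral of `f` has the law `S_α(‖f‖_α, 0, 0)`. -/
lemma IsStableIntegral.charFun_map [IsProbabilityMeasure P] (hα : 0 < α)
    (hM : IsSymmStableRandomMeasure α m P M) {f : E → ℝ} {X : Ω → ℝ}
    (hf : MemFAlpha α m f) (hX : IsStableIntegral α m P M f X) (θ : ℝ) :
    charFun (P.map X) θ = ((Real.exp (-((alphaEnergy α m f).toReal * |θ| ^ α)) : ℝ) : ℂ) := by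
  obtain ⟨φ, hφ, hφf, hφX⟩ := hX.exists_tendsto_ae
  have h1 := (tendstoInDistribution_of_ae_tendsto
    (fun n => (measurable_simpleStableIntegral hM (hφ n)).aemeasurable) hX.1.aemeasurable
    hφX).tendsto
  have h2 := ProbabilityMeasure.tendsto_iff_tendsto_charFun.1 h1 θ
  simp only [ProbabilityMeasure.coe_mk, charFun_simpleStableIntegral hα hM (hφ _)] at h2
  -- The characteristic functions of the approximating integrals have a second limit, given by
  -- continuity of the energy.
  refine tendsto_nhds_unique h2 ?_
  have h3 := (ENNReal.tendsto_toReal hf.2.ne).comp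
    (tendsto_alphaEnergy hα (fun n => (φ n).measurable) hf hφf)
  exact (Complex.continuous_ofReal.comp Real.continuous_exp).continuousAt.tendsto.comp
    ((h3.mul_const _).neg)

end Integral

/-! ### Convergence of finite-dimensional distributions and rescaling -/

section Localisability

/-- The Cramér–Wold device: it reduces joint laws to single integrals of linear combinations. The
Euclidean structure supplies the inner product in `charFun`. -/
lemma charFun_map_toLp {Ω : Type*} [MeasurableSpace Ω] {P : Measure Ω} {n : ℕ}
    {V : Fin n → Ω → ℝ} (hV : ∀ i, Measurable (V i)) (θ : EuclideanSpace ℝ (Fin n)) :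
    charFun (P.map fun ω => WithLp.toLp 2 fun i => V i ω) θ =
      charFun (P.map fun ω => ∑ i, θ i * V i ω) 1 := by
  have hm : Measurable fun ω => WithLp.toLp 2 fun i => V i ω :=
    (WithLp.measurable_toLp 2 (Fin n → ℝ)).comp (measurable_pi_lambda _ hV)
  have hs : Measurable fun ω => ∑ i, θ i * V i ω :=
    Finset.measurable_sum _ fun i _ => (hV i).const_mul _
  rw [charFun_apply, charFun_apply, integral_map hm.aemeasurable (by fun_prop),
    integral_map hs.aemeasurable (by fun_prop)]
  simp [PiLp.inner_apply]

variable {E Ω : Type*} [MeasurableSpace E] [MeasurableSpace Ω] {α : ℝ} {m : Measure E}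
  {P : Measure Ω} {M : Set E → Ω → ℝ}

/-- Vectors of stochastic integrals converge in distribution as soon as the energies of all linear
combinations of the integrands converge. -/
lemma tendstoInDistribution_stableIntegral [IsProbabilityMeasure P] (hα : 0 < α)
    (hM : IsSymmStableRandomMeasure α m P M) {ι : Type*} {l : Filter ι} [l.IsCountablyGenerated]
    {n : ℕ} {f : ι → Fin n → E → ℝ} {X : ι → Fin n → Ω → ℝ} {h : Fin n → E → ℝ}
    {Z : Fin n → Ω → ℝ} (hf : ∀ r i, MemFAlpha α m (f r i)) (hh : ∀ i, MemFAlpha α m (h i))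
    (hX : ∀ r i, IsStableIntegral α m P M (f r i) (X r i))
    (hZ : ∀ i, IsStableIntegral α m P M (h i) (Z i))
    (hlim : ∀ c : Fin n → ℝ, Tendsto (fun r => alphaEnergy α m fun x => ∑ i, c i * f r i x) l
      (𝓝 (alphaEnergy α m fun x => ∑ i, c i * h i x))) :
    TendstoInDistribution (fun r ω i => X r i ω) l (fun ω i => Z i ω) (fun _ => P) P := by
  have hmX : ∀ r, Measurable fun ω => WithLp.toLp 2 fun i => X r i ω := fun r =>
    (WithLp.measurable_toLp 2 (Fin n → ℝ)).comp (measurable_pi_lambda _ fun i => (hX r i).1)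
  have hmZ : Measurable fun ω => WithLp.toLp 2 fun i => Z i ω :=
    (WithLp.measurable_toLp 2 (Fin n → ℝ)).comp (measurable_pi_lambda _ fun i => (hZ i).1)
  have key : TendstoInDistribution (fun r ω => WithLp.toLp 2 fun i => X r i ω) l
      (fun ω => WithLp.toLp 2 fun i => Z i ω) (fun _ => P) P := by
    refine ⟨fun r => (hmX r).aemeasurable, hmZ.aemeasurable, ?_⟩
    -- The filter is countably generated, so sequences suffice, and to these Lévy's continuity
    -- theorem applies.
    refine tendsto_of_seq_tendsto fun r hr => ?_
    refine ProbabilityMeasure.tendsto_of_tendsto_charFun fun θ => ?_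
    have hfc : ∀ r, MemFAlpha α m fun x => ∑ i, θ i * f r i x := fun r =>
      MemFAlpha.sum hα _ fun i => (hf r i).const_mul hα _
    have hhc : MemFAlpha α m fun x => ∑ i, θ i * h i x :=
      MemFAlpha.sum hα _ fun i => (hh i).const_mul hα _
    simp only [ProbabilityMeasure.coe_mk]
    rw [charFun_map_toLp (fun i => (hZ i).1),
      (IsStableIntegral.sum hα hM Finset.univ hh hZ θ).charFun_map hα hM hhc]
    have h1 : ∀ k, charFun (P.map fun ω => WithLp.toLp 2 fun i => X (r k) i ω) θ =
        ((Real.exp (-((alphaEnergy α m fun x => ∑ i, θ i * f (r k) i x).toReal *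
          |(1 : ℝ)| ^ α)) : ℝ) : ℂ) := fun k => by
      rw [charFun_map_toLp (fun i => (hX (r k) i).1),
        (IsStableIntegral.sum hα hM Finset.univ (hf (r k)) (hX (r k)) θ).charFun_map hα hM
          (hfc (r k))]
    refine Tendsto.congr (fun k => (h1 k).symm) ?_
    have h3 := (ENNReal.tendsto_toReal hhc.2.ne).comp ((hlim θ).comp hr)
    exact (Complex.continuous_ofReal.comp Real.continuous_exp).continuousAt.tendsto.comp
      ((h3.mul_const _).neg)
  exact key.continuous_comp (g := fun x : EuclideanSpace ℝ (Fin n) => WithLp.ofLp x)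
    (PiLp.continuous_ofLp 2 _)

/-- The characteristic function of a null variable is 1 at `θ = 1`, which forces the exponent, and
so the energy, to vanish. -/
lemma ae_eq_zero_of_isStableIntegral [IsProbabilityMeasure P] (hα : 0 < α)
    (hM : IsSymmStableRandomMeasure α m P M) {f : E → ℝ} {X : Ω → ℝ} (hf : MemFAlpha α m f)
    (hX : IsStableIntegral α m P M f X) (h0 : X =ᵐ[P] 0) : f =ᵐ[m] 0 := by
  have h1 := hX.charFun_map hα hM hf 1
  have h2 : charFun (P.map X) 1 = 1 := by
    rw [charFun_apply, integral_map hX.1.aemeasurable (by fun_prop)]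
    rw [integral_congr_ae (g := fun _ => (1 : ℂ))]
    · simp
    · filter_upwards [h0] with ω hω
      simp [hω]
  rw [h2] at h1
  have h3 : (alphaEnergy α m f).toReal = 0 := by
    have h4 := (Complex.ofReal_eq_one.1 h1.symm)
    simpa using h4
  have h5 : alphaEnergy α m f = 0 :=
    ((ENNReal.toReal_eq_zero_iff _).1 h3).resolve_right hf.2.ne
  have hfm := hf.1
  rw [alphaEnergy, lintegral_eq_zero_iff (by fun_prop)] at h5
  filter_upwards [h5] with x hx
  simpa [ENNReal.rpow_eq_zero_iff, hα, hα.not_gt] using hx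

/-- Reflection and rescaling of the energy with respect to Lebesgue measure. -/
lemma alphaEnergy_comp_sub_left (hα : 0 < α) {G : ℝ → ℝ} (u : ℝ) {r : ℝ} (hr : 0 < r) :
    alphaEnergy α volume (fun x => G (u - x)) =
      alphaEnergy α volume (fun z => r ^ (1 / α) * G (r * z)) := by
  rw [alphaEnergy_const_mul hα]
  unfold alphaEnergy
  rw [lintegral_sub_left_eq_self (fun x => ‖G x‖ₑ ^ α) u]
  have h1 := lintegral_map_equiv (μ := (volume : Measure ℝ)) (fun x => ‖G x‖ₑ ^ α)
    (Homeomorph.mulLeft₀ r hr.ne').toMeasurableEquiv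
  have h2 : (Homeomorph.mulLeft₀ r hr.ne').toMeasurableEquiv = fun x => r * x := rfl
  simp only [h2] at h1
  rw [Real.map_volume_mul_left hr.ne', lintegral_smul_measure, smul_eq_mul,
    abs_of_pos (inv_pos.2 hr)] at h1
  have h3 : ‖r ^ (1 / α)‖ₑ ^ α = ENNReal.ofReal r := by
    rw [Real.enorm_of_nonneg (by positivity), ENNReal.ofReal_rpow_of_nonneg (by positivity) hα.le,
      ← Real.rpow_mul hr.le, one_div, inv_mul_cancel₀ hα.ne', Real.rpow_one]
  rw [h3, ← h1, ← mul_assoc, ← ENNReal.ofReal_mul hr.le, mul_inv_cancel₀ hr.ne',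
    ENNReal.ofReal_one, one_mul]

end Localisability

/-! ### The localisability theorem -/

theorem proposition2p1 {Ω : Type*} [MeasurableSpace Ω] (P : Measure Ω) [IsProbabilityMeasure P]
    (α : ℝ) (hα0 : 0 < α) (hα2 : α ≤ 2)
    (M : Set ℝ → Ω → ℝ) (hM : IsSymmStableRandomMeasure α (volume : Measure ℝ) P M)
    (g : ℝ → ℝ) (hg : MemFAlpha α (volume : Measure ℝ) g)
    (Y : ℝ → Ω → ℝ)
    (hY : ∀ t : ℝ, Y t =ᵐ[P] stableIntegral α (volume : Measure ℝ) P M (fun x => g (t - x)))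
    (γ : ℝ) (hγ : 0 < γ + 1 / α)
    (h : ℝ → ℝ → ℝ) (h_meas : Measurable (Function.uncurry h))
    (h_mem : ∀ t : ℝ, MemFAlpha α (volume : Measure ℝ) (h t))
    (h_nontrivial : ∃ t : ℝ, ¬ (h t =ᵐ[(volume : Measure ℝ)] 0))
    (h_lim : ∀ t : ℝ,
      Tendsto (fun r : ℝ => ∫⁻ z : ℝ, ‖(g (r * (t + z)) - g (r * z)) / r ^ γ - h t z‖ₑ ^ α)
        (𝓝[>] (0 : ℝ)) (𝓝 0)) :
    ∀ u : ℝ, IsLocalisableAt P P (γ + 1 / α) Y u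
      (fun t => stableIntegral α (volume : Measure ℝ) P M (h t)) := by
  intro u
  refine ⟨hγ, ?_, fun n t => ?_⟩
  · obtain ⟨t, ht⟩ := h_nontrivial
    exact ⟨t, fun h0 => ht (ae_eq_zero_of_isStableIntegral hα0 hM (h_mem t)
      (isStableIntegral_stableIntegral hα0 hM (h_mem t)) h0)⟩
  have hgm := hg.1
  have hgs : ∀ s, MemFAlpha α volume fun x => g (s - x) := fun s =>
    ⟨by fun_prop, by rw [lintegral_sub_left_eq_self (fun x => ‖g x‖ₑ ^ α) s]; exact hg.2⟩
  have hgi := fun s => isStableIntegral_stableIntegral hα0 hM (hgs s)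
  have main := tendstoInDistribution_stableIntegral (l := 𝓝[>] (0 : ℝ)) hα0 hM
    (f := fun r i x => r ^ (-(γ + 1 / α)) * g (u + r * t i - x) +
      (-r ^ (-(γ + 1 / α))) * g (u - x))
    (h := fun i => h (t i))
    (fun r i => ((hgs _).const_mul hα0 _).add hα0 ((hgs _).const_mul hα0 _))
    (fun i => h_mem (t i))
    (fun r i => (hgi (u + r * t i)).linearComb hα0 hM (hgs _) (hgi u) _ _)
    (fun i => isStableIntegral_stableIntegral hα0 hM (h_mem (t i))) ?_
  · refine main.congr (fun r => ?_) (EventuallyEq.refl _ _)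
    filter_upwards [ae_all_iff.2 fun i => hY (u + r * t i), hY u] with ω h1 h2
    ext i
    rw [h1, h2]
    ring
  · intro c
    -- This is the linear combination of increments after the substitution `x = u - rz`; it no
    -- longer depends on `u`.
    set F : ℝ → ℝ → ℝ := fun r z => ∑ i, c i * ((g (r * (t i + z)) - g (r * z)) / r ^ γ) with hF
    have hFm : ∀ r, Measurable (F r) := fun r => by simp only [hF]; fun_prop
    have hc : MemFAlpha α volume fun z => ∑ i, c i * h (t i) z :=
      MemFAlpha.sum hα0 _ fun i => (h_mem (t i)).const_mul hα0 _
    have hconv : Tendsto (fun r => alphaEnergy α volume (F r)) (𝓝[>] 0)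
        (𝓝 (alphaEnergy α volume fun z => ∑ i, c i * h (t i) z)) := by
      refine tendsto_alphaEnergy hα0 hFm hc ?_
      have hht : ∀ i, Measurable (h (t i)) := fun i => (h_mem (t i)).1
      have := tendsto_alphaEnergy_sum (m := (volume : Measure ℝ)) hα0 Finset.univ
        (F := fun i r z => c i * ((g (r * (t i + z)) - g (r * z)) / r ^ γ - h (t i) z))
        (fun i r => by have := hht i; fun_prop)
        (fun i => tendsto_alphaEnergy_const_mul hα0 (c i) (h_lim (t i)))
      simpa only [hF, mul_sub, Finset.sum_sub_distrib] using this
    refine hconv.congr' ?_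
    filter_upwards [self_mem_nhdsWithin] with r hr
    have hr : 0 < r := hr
    have hs := alphaEnergy_comp_sub_left hα0
      (G := fun y => ∑ i, c i * (r ^ (-(γ + 1 / α)) * g (y + r * t i) +
        (-r ^ (-(γ + 1 / α))) * g y)) u hr
    have e1 : (fun x => ∑ i, c i * (r ^ (-(γ + 1 / α)) * g (u + r * t i - x) +
        (-r ^ (-(γ + 1 / α))) * g (u - x))) = fun x => ∑ i, c i * (r ^ (-(γ + 1 / α)) *
        g (u - x + r * t i) + (-r ^ (-(γ + 1 / α))) * g (u - x)) := by
      ext x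
      simp_rw [show ∀ i, u + r * t i - x = u - x + r * t i from fun i => by ring]
    rw [e1, hs]
    congr 1
    ext z
    simp only [hF]
    rw [Finset.mul_sum]
    refine Finset.sum_congr rfl fun i _ => ?_
    -- The Jacobian factor absorbs the `1 / α` in the localisability exponent, leaving the
    -- normalisation `r^γ` of the hypothesis on `h`.
    have hp : r ^ (1 / α) * r ^ (-(γ + 1 / α)) = (r ^ γ)⁻¹ := by
      rw [← Real.rpow_add hr, ← Real.rpow_neg hr.le]
      congr 1
      ring
    rw [show r * (t i + z) = r * z + r * t i by ring, div_eq_mul_inv, ← hp]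
    ring
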